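/- For $\theta\in\mathbb R$ let $\mathbb C_\theta=\{s\in\mathbb C:\operatorname{Re}s>\theta\}$. Let $\mathcal A^+$ be the Banach space of functions $f(s)=\sum_{n\ge1}a_nn^{-s}$ on $\mathbb C_0$ with $\|f\|_{\mathcal A^+}=\sum_{n\ge1}|a_n|<\infty$, and let $\mathcal D$ be the space of analytic functions on $\mathbb C_0$ that are representable by a convergent Dirichlet series $\sum_{n\ge1}c_nn^{-s}$ for $\operatorname{Re}s$ large enough. Let $\phi:\mathbb C_0\to\mathbb C$ be a non-constant function of the form $\phi(s)=c_0s+\varphi(s)$ with $c_0\in\mathbb N_0=\{0,1,2,\dots\}$ and $\varphi\in\mathcal D$, and let $C_\phi f=f\circ\phi$; for $f=\sum a_nn^{-s}\in\mathcal A^+$, $f\circ\phi$ is said to be defined if $\sum a_nn^{-\phi(s)}$ converges absolutely for every $s\in\mathbb C_0$, and then $(f\circ\phi)(s)$ is its sum. That $C_\phi$ maps $\mathcal A^+$ into itself means that $f\circ\phi$ is defined and lies in $\mathcal A^+$ for every $f\in\mathcal A^+$. Then: (a) (i) If $C_\phi$ maps $\mathcal A^+$ into itself, then $n^{-\phi}\in\mathcal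 A^+$ for all $n\ge1$ and there is a constant $C$ with $\|n^{-\phi}\|_{\mathcal A^+}\le C$ for all $n\ge1$. (ii) Conversely, if $n^{-\phi}\in\mathcal A^+$ for all $n\ge1$ and $\sup_{n\ge 1}\|n^{-\phi}\|_{\mathcal A^+}<\infty$, then $\phi(\mathbb C_0)\subseteq\mathbb C_0$ and $C_\phi$ is a bounded operator from $\mathcal A^+$ to $\mathcal A^+$. (b) (i) $C_\phi$ is a compact operator from $\mathcal A^+$ to $\mathcal A^+$ if and only if $n^{-\phi}\in\mathcal A^+$ for all $n\ge1$ and $\|n^{-\phi}\|_{\mathcal A^+}\to0$ as $n\to\infty$. In that case $\phi(\mathbb C_0)\subseteq\mathbb C_\delta$ for some $\delta>0$. (ii) Suppose that the coefficients $c_n$ of $\varphi$ (where $\varphi(s)=\sum_{n\ge1}c_nn^{-s}$ for $\operatorname{Re}s$ large) satisfy $\sum_{n\ge1}|c_n|<\infty$. Then $C_\phi$ is compact if and only if $\phi(\mathbb C_0)\subseteq\mathbb C_\delta$ for some $\delta>0$. -/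

import Mathlib

open Filter Topology Set

noncomputable section

namespace WienerDirichlet

/-- The open vertical half-plane `Re s > θ`. -/
def halfPlane (θ : ℝ) : Set ℂ := {s | θ < s.re}

/-- The Wiener-Dirichlet algebra `𝒜⁺` as a Banach space: an element is a Dirichlet series
`∑_{n ≥ 1} a_n n^{-s}` given by its coefficients, with norm `∑ |a_n| < ∞`. -/
abbrev WD : Type := lp (fun _ : ℕ+ => ℂ) 1

/-- The function on `Re s > 0` defined by an element of `𝒜⁺`: `f(s) = ∑ a_n n^{-s}`. -/
def WD.eval (f : WD) (s : ℂ) : ℂ := ∑' n : ℕ+, f n * ((n : ℕ) : ℂ) ^ (-s)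

/-- The function `F`, considered on `Re s > 0`, is (the function defined by) the element `f`
of `𝒜⁺`. -/
def Represents (f : WD) (F : ℂ → ℂ) : Prop := EqOn f.eval F (halfPlane 0)

/-- `ϕ(s) = ∑ c_n n^{-s}`, as a convergent (not necessarily absolutely convergent) series, for
all `s` of sufficiently large real part. -/
def HasDirichletExpansion (ϕ : ℂ → ℂ) (c : ℕ+ → ℂ) : Prop :=
  ∃ σ : ℝ, ∀ s : ℂ, σ < s.re →
    Tendsto (fun N : ℕ+ => ∑ n ∈ Finset.Icc 1 N, c n * ((n : ℕ) : ℂ) ^ (-s)) atTop (𝓝 (ϕ s))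

/-- The space `𝒟` of convergent Dirichlet series: functions analytic on `Re s > 0` which are
representable as a convergent Dirichlet series for `Re s` large enough. -/
def IsConvergentDirichletSeries (ϕ : ℂ → ℂ) : Prop :=
  DifferentiableOn ℂ ϕ (halfPlane 0) ∧ ∃ c : ℕ+ → ℂ, HasDirichletExpansion ϕ c

/-- `g = f ∘ φ` on `Re s > 0`: at each such `s` the Dirichlet series of `f` converges absolutely
at `φ s`, with sum `g(s)`. (This makes sense before `φ` is known to map `Re s > 0` into itself.) -/
def IsComp (φ : ℂ → ℂ) (f g : WD) : Prop :=
  ∀ s ∈ halfPlane 0, HasSum (fun n : ℕ+ => f n * ((n : ℕ) : ℂ) ^ (-φ s)) (g.eval s)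

/-- `C_φ` maps `𝒜⁺` into itself. -/
def CompMapsInto (φ : ℂ → ℂ) : Prop := ∀ f : WD, ∃ g : WD, IsComp φ f g

/-- `C_φ` is a bounded operator `𝒜⁺ → 𝒜⁺`. -/
def CompBounded (φ : ℂ → ℂ) : Prop := ∃ T : WD →L[ℂ] WD, ∀ f : WD, IsComp φ f (T f)

/-- `C_φ` is a compact operator `𝒜⁺ → 𝒜⁺`. -/
def CompCompact (φ : ℂ → ℂ) : Prop :=
  ∃ T : WD →L[ℂ] WD, (∀ f : WD, IsComp φ f (T f)) ∧ IsCompactOperator T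

/-- Every `n^{-φ}` lies in `𝒜⁺`, being represented there by `g n`. -/
def PowersRepresentedBy (φ : ℂ → ℂ) (g : ℕ+ → WD) : Prop :=
  ∀ n : ℕ+, Represents (g n) (fun s => ((n : ℕ) : ℂ) ^ (-φ s))

/-- `n^{-φ} ∈ 𝒜⁺` for all `n ≥ 1`, with `‖n^{-φ}‖ ≤ C` for some `C` independent of `n`. -/
def PowersBounded (φ : ℂ → ℂ) : Prop :=
  ∃ g : ℕ+ → WD, PowersRepresentedBy φ g ∧ ∃ C : ℝ, ∀ n, ‖g n‖ ≤ C

/-- `n^{-φ} ∈ 𝒜⁺` for all `n ≥ 1`, and `‖n^{-φ}‖ → 0`. -/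
def PowersTendToZero (φ : ℂ → ℂ) : Prop :=
  ∃ g : ℕ+ → WD, PowersRepresentedBy φ g ∧ Tendsto (fun n => ‖g n‖) atTop (𝓝 0)

end WienerDirichlet

end

/-!
A linear operator on `𝒜⁺ ≅ ℓ¹` is determined by the images of the `n^{-s}`, and any bounded family
of images defines one. Together with the uniform boundedness principle and the closed graph theorem
this gives (a). If the images tend to `0`, the operator is a norm limit of operators of finite rank;
conversely a compact operator sends the bounded sequence `n^{-s}`, whose images `n^{-φ}` tend to `0`
pointwise, to a sequence tending to `0` in norm.

For (b)(ii) let `f` be the element of `𝒜⁺` defined by `φ(s) - c₀ s`. Then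
`n^{-φ} = n^{-c₀ s} exp(-(log n) f)`, so it suffices that `exp(-t f) → 0` as `t → ∞`, where `f` acts
on `𝒜⁺` by multiplication. By Gelfand theory this holds once `Re ∑ f(n) χ(n) ≥ δ` for every bounded
character `χ` of the multiplicative monoid `ℕ+`. On the imaginary axis `Re f ≥ δ`. If `χ` is
summable and `V(s) = ∑ χ(n) n^{-s}`, averaging `f(it) |V(-it)|²` over `t` leaves only the
frequencies with `n = km`, and by multiplicativity the mean is `(∑ f(k) χ(k)) ∑ |χ(m)|²`. A general
`χ` is the pointwise limit of its products with summable characters supported on smooth numbers.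
-/

noncomputable section

namespace WienerDirichlet

/-! ### Operators on `ℓ¹` given by bounded families -/

section Synthesis

variable {ι 𝕜 E : Type*} [NontriviallyNormedField 𝕜]
  [NormedAddCommGroup E] [NormedSpace 𝕜 E] [CompleteSpace E]
  {g : ι → E} {C : ℝ}

/-- The synthesis operator `f ↦ ∑ i, f i • g i` on `ℓ¹` of a bounded family `g`. The bound `C` is
replaced by `max C 0` because `C` may be negative when `ι` is empty. -/
def synth (hg : ∀ i, ‖g i‖ ≤ C) : lp (fun _ : ι => 𝕜) 1 →L[𝕜] E :=
  lp.tsumCLM 𝕜 ι E ∘L lp.mapCLM 1 (fun i => .toSpanSingleton 𝕜 (g i)) (le_max_right C 0)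
    fun i => by simpa using .inl (hg i)

theorem hasSum_synth (hg : ∀ i, ‖g i‖ ≤ C) (f : lp (fun _ : ι => 𝕜) 1) :
    HasSum (fun i => f i • g i) (synth hg f) := by
  let u := lp.mapCLM 1 (fun i => .toSpanSingleton 𝕜 (g i)) (le_max_right C 0)
    (fun i => by simpa using .inl (hg i)) f
  have hu : Summable fun i => ‖u i‖ := by simpa using (lp.memℓp u).summable
  exact hu.of_norm.hasSum

theorem norm_synth_le (hC : 0 ≤ C) (hg : ∀ i, ‖g i‖ ≤ C) :
    ‖(synth hg : lp (fun _ : ι => 𝕜) 1 →L[𝕜] E)‖ ≤ C :=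
  calc _ ≤ ‖lp.tsumCLM 𝕜 ι E‖ * ‖_‖ := ContinuousLinearMap.opNorm_comp_le _ _
    _ ≤ 1 * max C 0 := by
      gcongr
      exacts [lp.norm_tsumCLM_le, lp.norm_mapCLM_le ..]
    _ = C := by rw [one_mul, max_eq_left hC]

@[simp]
theorem synth_single [DecidableEq ι] (hg : ∀ i, ‖g i‖ ≤ C) (i : ι) (a : 𝕜) :
    synth hg (lp.single 1 i a) = a • g i := by
  refine (hasSum_synth hg _).unique ?_
  convert hasSum_single i fun j hj => ?_ using 1 <;> simp [*]

theorem eq_synth [DecidableEq ι] (hg : ∀ i, ‖g i‖ ≤ C)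
    (L : lp (fun _ : ι => 𝕜) 1 →L[𝕜] E)
    (hL : ∀ i, L (lp.single 1 i 1) = g i) : L = synth hg :=
  lp.ext_continuousLinearMap ENNReal.one_ne_top fun i => by ext; simp [hL]

theorem tendsto_synth {α : Type*} {l : Filter α} {G : α → ι → E}
    (hG : ∀ a i, ‖G a i‖ ≤ C) (hg : ∀ i, ‖g i‖ ≤ C)
    (h : ∀ i, Tendsto (fun a => G a i) l (𝓝 (g i))) (f : lp (fun _ : ι => 𝕜) 1) :
    Tendsto (fun a => synth (hG a) f) l (𝓝 (synth hg f)) := by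
  have hf : Summable fun i => ‖f i‖ * C := by
    simpa using ((lp.memℓp f).summable (by simp)).mul_right C
  simp only [← (hasSum_synth _ f).tsum_eq]
  refine tendsto_tsum_of_dominated_convergence hf (fun i => (h i).const_smul (f i))
    (.of_forall fun a i => ?_)
  rw [norm_smul]
  exact mul_le_mul_of_nonneg_left (hG a i) (norm_nonneg _)

theorem isCompactOperator_synth [LocallyCompactSpace 𝕜] (hg : ∀ i, ‖g i‖ ≤ C)
    (h0 : Tendsto g cofinite (𝓝 0)) :
    IsCompactOperator (synth hg : lp (fun _ : ι => 𝕜) 1 →L[𝕜] E) := by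
  classical
  let S : Finset ι → lp (fun _ : ι => 𝕜) 1 →L[𝕜] E := fun s =>
    ∑ i ∈ s, .toSpanSingleton 𝕜 (g i) ∘L lp.evalCLM 𝕜 (fun _ => 𝕜) 1 i
  have hS : ∀ s, IsCompactOperator (S s) := fun s =>
    Submodule.sum_mem (compactOperator (RingHom.id 𝕜) _ E) fun i _ =>
      (isCompactOperator_of_locallyCompactSpace_rng (.toSpanSingleton 𝕜 (g i))).comp_clm _
  refine isCompactOperator_of_tendsto (l := atTop) (F := S) ?_ (.of_forall hS)
  refine Metric.tendsto_nhds.2 fun ε hε => ?_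
  have hfin : {i | ¬ ‖g i‖ ≤ ε / 2}.Finite :=
    (tendsto_zero_iff_norm_tendsto_zero.1 h0).eventually_le_const (half_pos hε)
  filter_upwards [eventually_ge_atTop hfin.toFinset] with s hs
  have htail : ∀ i, ‖if i ∈ s then 0 else g i‖ ≤ ε / 2 := fun i => by
    split_ifs with hi
    · simpa using (half_pos hε).le
    · by_contra h
      exact hi (hs (by simpa using h))
  have hrest : synth hg - S s = synth htail := eq_synth htail _ fun i => by
    have hSi : S s (lp.single 1 i 1) = if i ∈ s then g i else 0 := by
      have (j : ι) : lp.evalCLM 𝕜 (fun _ => 𝕜) 1 j (lp.single 1 i 1) = if j = i then 1 else 0 := by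
        simp [lp.evalCLM, Pi.single_apply]
      simp [S, this]
    rw [sub_apply, synth_single, hSi, one_smul]
    split_ifs <;> simp
  rw [dist_comm, dist_eq_norm, hrest]
  exact (norm_synth_le (half_pos hε).le htail).trans_lt (half_lt_self hε)

theorem exists_norm_le_of_forall_summable [CompleteSpace 𝕜] {c : ι → 𝕜}
    (hc : ∀ f : lp (fun _ : ι => 𝕜) 1, Summable fun i => f i * c i) : ∃ C, ∀ i, ‖c i‖ ≤ C := by
  classical
  let u : ι → lp (fun _ : ι => 𝕜) 1 →L[𝕜] 𝕜 := fun i => c i • lp.evalCLM 𝕜 (fun _ => 𝕜) 1 i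
  have hu : ∀ f, ∃ C, ∀ i, ‖u i f‖ ≤ C := fun f => by
    obtain ⟨C, hC⟩ := (hc f).tendsto_cofinite_zero.norm.bddAbove_range_of_cofinite
    exact ⟨C, fun i => (congrArg norm (mul_comm (c i) (f i))).trans_le (hC ⟨i, rfl⟩)⟩
  obtain ⟨C, hC⟩ := banach_steinhaus hu
  refine ⟨C, fun i => ?_⟩
  have : ‖u i (lp.single 1 i 1)‖ = ‖c i‖ := by simp [u, lp.evalCLM]
  simpa [this, lp.norm_single] using (u i).le_of_opNorm_le (hC i) (lp.single 1 i 1)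

end Synthesis

section FunctionalAnalysis

variable {ι 𝕜 E F : Type*} [NontriviallyNormedField 𝕜]
  [NormedAddCommGroup E] [NormedSpace 𝕜 E] [NormedAddCommGroup F] [NormedSpace 𝕜 F]

theorem exists_clm_of_comp_separating [CompleteSpace E] [CompleteSpace F]
    {ℓ : ι → F →L[𝕜] 𝕜} (hℓ : ∀ x y, (∀ i, ℓ i x = ℓ i y) → x = y)
    {m : ι → E →L[𝕜] 𝕜} {T : E → F} (hT : ∀ i x, ℓ i (T x) = m i x) :
    ∃ S : E →L[𝕜] F, ∀ x, S x = T x := by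
  let S : E →ₗ[𝕜] F :=
    { toFun := T
      map_add' := fun x y => hℓ _ _ fun i => by simp [hT]
      map_smul' := fun c x => hℓ _ _ fun i => by simp [hT] }
  refine ⟨.ofSeqClosedGraph (g := S) fun u x y hu hSu => hℓ _ _ fun i => ?_, fun x => rfl⟩
  have h₁ : Tendsto (fun n => m i (u n)) atTop (𝓝 (ℓ i y)) :=
    (((ℓ i).continuous.tendsto y).comp hSu).congr fun n => hT i (u n)
  have h₂ : Tendsto (fun n => m i (u n)) atTop (𝓝 (m i x)) :=
    ((m i).continuous.tendsto x).comp hu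
  exact (tendsto_nhds_unique h₁ h₂).trans (hT i x).symm

theorem tendsto_zero_of_isCompactOperator {α : Type*} {T : E →L[𝕜] F}
    (hT : IsCompactOperator T) {ℓ : ι → F →L[𝕜] 𝕜} (hℓ : ∀ y, (∀ i, ℓ i y = 0) → y = 0)
    {l : Filter α} {x : α → E} {r : ℝ} (hx : ∀ a, ‖x a‖ ≤ r)
    (h : ∀ i, Tendsto (fun a => ℓ i (T (x a))) l (𝓝 0)) :
    Tendsto (fun a => T (x a)) l (𝓝 0) := by
  have hmem : ∀ a, T (x a) ∈ closure (T '' Metric.closedBall 0 r) := fun a =>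
    subset_closure ⟨x a, by simpa using hx a, rfl⟩
  refine (hT.isCompact_closure_image_closedBall r).tendsto_nhds_of_unique_mapClusterPt
    (.of_forall hmem) fun y _ hy => hℓ y fun i => ?_
  have hcluster : MapClusterPt (ℓ i y) l (fun a => ℓ i (T (x a))) :=
    hy.continuousAt_comp (ℓ i).continuous.continuousAt
  exact eq_of_nhds_neBot (hcluster.clusterPt.mono (h i))

end FunctionalAnalysis

theorem comp_exp_of_comp_eq_smul {𝕜 E F : Type*} [RCLike 𝕜] [NormedAddCommGroup E]
    [NormedSpace 𝕜 E] [CompleteSpace E] [NormedAddCommGroup F] [NormedSpace 𝕜 F]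
    {L : E →L[𝕜] F} {T : E →L[𝕜] E} {z : 𝕜} (h : L ∘L T = z • L) :
    L ∘L NormedSpace.exp T = NormedSpace.exp z • L := by
  have hpow : ∀ n : ℕ, L ∘L T ^ n = z ^ n • L := fun n => by
    induction n with
    | zero => ext; simp
    | succ n ih =>
      rw [pow_succ, ContinuousLinearMap.mul_def, ← ContinuousLinearMap.comp_assoc, ih,
        ContinuousLinearMap.smul_comp, h, smul_smul, pow_succ]
  have hL := (NormedSpace.exp_series_hasSum_exp' (𝕂 := 𝕜) T).mapL (L.postcomp E)
  have hz := (NormedSpace.exp_series_hasSum_exp' (𝕂 := 𝕜) z).smul_const L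
  refine hL.unique (hz.congr_fun fun n => ?_)
  rw [map_smul, ContinuousLinearMap.postcomp_apply, hpow, smul_smul, smul_eq_mul]

/-! ### Evaluation -/

/-- The element `n^{-s}` of `𝒜⁺`. -/
def basis (n : ℕ+) : WD := lp.single 1 n 1

@[simp]
theorem norm_basis (n : ℕ+) : ‖basis n‖ = 1 := by
  simp [basis, lp.norm_single]

@[simp]
theorem synth_basis {E : Type*} [NormedAddCommGroup E] [NormedSpace ℂ E] [CompleteSpace E]
    {g : ℕ+ → E} {C : ℝ} (hg : ∀ n, ‖g n‖ ≤ C) (n : ℕ+) : synth hg (basis n) = g n := by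
  simp [basis]

theorem norm_cpow_neg (n : ℕ+) (s : ℂ) : ‖((n : ℕ) : ℂ) ^ (-s)‖ = ((n : ℕ) : ℝ) ^ (-s.re) := by
  simpa using Complex.norm_natCast_cpow_of_pos n.pos (-s)

theorem norm_cpow_neg_le_one {s : ℂ} (hs : 0 ≤ s.re) (n : ℕ+) : ‖((n : ℕ) : ℂ) ^ (-s)‖ ≤ 1 := by
  rw [norm_cpow_neg]
  exact Real.rpow_le_one_of_one_le_of_nonpos (Nat.one_le_cast.2 n.pos) (neg_nonpos.2 hs)

theorem re_nonneg_of_norm_cpow_neg_le {w : ℂ} {C : ℝ}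
    (h : ∀ n : ℕ+, ‖((n : ℕ) : ℂ) ^ (-w)‖ ≤ C) : 0 ≤ w.re := by
  by_contra! hw
  have hlim : Tendsto (fun n : ℕ+ => ‖((n : ℕ) : ℂ) ^ (-w)‖) atTop atTop := by
    simp only [norm_cpow_neg]
    exact (tendsto_rpow_atTop (neg_pos.2 hw)).comp
      (tendsto_natCast_atTop_atTop.comp tendsto_PNat_val_atTop_atTop)
  obtain ⟨n, hn⟩ := (hlim.eventually_gt_atTop C).exists
  exact (h n).not_gt hn

theorem tendsto_cpow_neg {w : ℂ} (hw : 0 < w.re) :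
    Tendsto (fun n : ℕ+ => ((n : ℕ) : ℂ) ^ (-w)) atTop (𝓝 0) := by
  rw [tendsto_zero_iff_norm_tendsto_zero]
  simp only [norm_cpow_neg]
  exact (tendsto_rpow_neg_atTop hw).comp
    (tendsto_natCast_atTop_atTop.comp tendsto_PNat_val_atTop_atTop)

/-- Evaluation at a point of the closed right half-plane, as a bounded functional on `𝒜⁺`. -/
def evalCLM {s : ℂ} (hs : 0 ≤ s.re) : WD →L[ℂ] ℂ := synth (norm_cpow_neg_le_one hs)

theorem hasSum_eval (f : WD) {s : ℂ} (hs : 0 ≤ s.re) :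
    HasSum (fun n : ℕ+ => f n * ((n : ℕ) : ℂ) ^ (-s)) (f.eval s) :=
  (hasSum_synth (norm_cpow_neg_le_one hs) f).summable.hasSum

@[simp]
theorem evalCLM_apply {s : ℂ} (hs : 0 ≤ s.re) (f : WD) : evalCLM hs f = f.eval s :=
  (hasSum_synth _ f).unique (hasSum_eval f hs)

theorem norm_eval_le (f : WD) {s : ℂ} (hs : 0 ≤ s.re) : ‖f.eval s‖ ≤ ‖f‖ := by
  simpa using (evalCLM hs).le_of_opNorm_le (norm_synth_le zero_le_one _) f

@[simp]
theorem eval_basis (n : ℕ+) {s : ℂ} (hs : 0 ≤ s.re) :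
    (basis n).eval s = ((n : ℕ) : ℂ) ^ (-s) := by
  rw [← evalCLM_apply hs, evalCLM, synth_basis]

theorem summable_norm_coeff (f : WD) : Summable fun n => ‖f n‖ := by
  simpa using (lp.memℓp f).summable

theorem norm_coeff_mul_cpow_neg_le (f : WD) {s : ℂ} (hs : 0 ≤ s.re) (n : ℕ+) :
    ‖f n * ((n : ℕ) : ℂ) ^ (-s)‖ ≤ ‖f n‖ := by
  rw [norm_mul]
  exact mul_le_of_le_one_right (norm_nonneg _) (norm_cpow_neg_le_one hs n)

theorem isOpen_halfPlane (θ : ℝ) : IsOpen (halfPlane θ) :=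
  isOpen_lt continuous_const Complex.continuous_re

theorem isPreconnected_halfPlane (θ : ℝ) : IsPreconnected (halfPlane θ) :=
  (convex_halfSpace_re_gt θ).isPreconnected

theorem differentiable_cpow_neg (n : ℕ+) : Differentiable ℂ fun s : ℂ => ((n : ℕ) : ℂ) ^ (-s) :=
  differentiable_neg.const_cpow (.inl (Nat.cast_ne_zero.2 n.ne_zero))

theorem continuousOn_eval (f : WD) : ContinuousOn f.eval {s | 0 ≤ s.re} :=
  continuousOn_tsum
    (fun n => ((differentiable_cpow_neg n).continuous.const_mul (f n)).continuousOn)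
    (summable_norm_coeff f) fun n _ hs => norm_coeff_mul_cpow_neg_le f hs n

theorem differentiableOn_eval (f : WD) : DifferentiableOn ℂ f.eval (halfPlane 0) :=
  Complex.differentiableOn_tsum_of_summable_norm (summable_norm_coeff f)
    (fun n => ((differentiable_cpow_neg n).const_mul (f n)).differentiableOn)
    (isOpen_halfPlane 0) fun n _ hs => norm_coeff_mul_cpow_neg_le f (le_of_lt hs) n

theorem lseriesHasSum_extend (f : WD) {s : ℂ} (hs : 0 ≤ s.re) :
    LSeriesHasSum (Function.extend PNat.val f 0) s (f.eval s) := by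
  have h0 : Function.extend PNat.val f 0 0 = 0 :=
    Function.extend_apply' _ _ _ fun ⟨n, hn⟩ => n.ne_zero hn
  have hterm : LSeries.term (Function.extend PNat.val f 0) s =
      Function.extend PNat.val (fun n => f n * ((n : ℕ) : ℂ) ^ (-s)) 0 := by
    ext n
    rw [LSeries.term_def₀ h0]
    obtain rfl | hn := n.eq_zero_or_pos
    · simp
    · lift n to ℕ+ using hn
      simp [PNat.coe_injective.extend_apply]
  rw [LSeriesHasSum, hterm, hasSum_extend_zero PNat.coe_injective]
  exact hasSum_eval f hs

theorem eq_of_eval_eq {f g : WD} (h : ∀ s ∈ halfPlane 0, f.eval s = g.eval s) : f = g := by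
  have habs (f : WD) : LSeries.abscissaOfAbsConv (Function.extend PNat.val f 0) < ⊤ :=
    (LSeriesSummable.abscissaOfAbsConv_le (s := 1)
      (lseriesHasSum_extend f (by simp)).summable).trans_lt (EReal.coe_lt_top 1)
  have heq : (fun x : ℝ => LSeries (Function.extend PNat.val f 0) x) =ᶠ[atTop]
      fun x => LSeries (Function.extend PNat.val g 0) x := by
    filter_upwards [eventually_gt_atTop 0] with x hx
    have hx' : (x : ℂ) ∈ halfPlane 0 := by simpa [halfPlane] using hx
    rw [(lseriesHasSum_extend f (le_of_lt hx')).LSeries_eq,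
      (lseriesHasSum_extend g (le_of_lt hx')).LSeries_eq, h _ hx']
  ext n
  simpa [PNat.coe_injective.extend_apply] using
    LSeries.eq_of_LSeries_eventually_eq (habs f) (habs g) heq n.ne_zero

theorem eq_zero_of_eval_eq_zero {f : WD} (h : ∀ s ∈ halfPlane 0, f.eval s = 0) : f = 0 :=
  eq_of_eval_eq fun s hs => (h s hs).trans (by rw [← evalCLM_apply (le_of_lt hs), map_zero])

/-! ### Boundedness and compactness of composition operators -/

section Composition

variable {φ : ℂ → ℂ} {g : ℕ+ → WD}

theorem CompMapsInto.re_nonneg (h : CompMapsInto φ) {s : ℂ} (hs : s ∈ halfPlane 0) :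
    0 ≤ (φ s).re := by
  obtain ⟨C, hC⟩ := exists_norm_le_of_forall_summable (c := fun n : ℕ+ => ((n : ℕ) : ℂ) ^ (-φ s))
    fun f => by
      obtain ⟨g, hg⟩ := h f
      exact (hg s hs).summable
  exact re_nonneg_of_norm_cpow_neg_le hC

theorem CompMapsInto.compBounded (h : CompMapsInto φ) : CompBounded φ := by
  have hre (s : halfPlane 0) : 0 ≤ (φ s).re := h.re_nonneg s.2
  choose T hT using h
  obtain ⟨S, hS⟩ := exists_clm_of_comp_separating
    (ℓ := fun s : halfPlane 0 => evalCLM (le_of_lt s.2)) (m := fun s => evalCLM (hre s)) (T := T)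
    (fun f g hfg => eq_of_eval_eq fun s hs => by simpa using hfg ⟨s, hs⟩)
    fun s f => by simpa using (hT f s s.2).unique (hasSum_eval f (hre s))
  exact ⟨S, fun f => hS f ▸ hT f⟩

theorem powersRepresentedBy_of_isComp {T : WD → WD} (hT : ∀ f, IsComp φ f (T f)) :
    PowersRepresentedBy φ fun n => T (basis n) := fun n s hs => by
  refine (hT _ s hs).unique ?_
  convert hasSum_single n fun m hm => ?_ using 1 <;> simp [basis, *]

theorem CompBounded.powersBounded (h : CompBounded φ) : PowersBounded φ := by
  obtain ⟨T, hT⟩ := h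
  exact ⟨_, powersRepresentedBy_of_isComp hT, ‖T‖, fun n => by
    simpa using T.le_opNorm (basis n)⟩

theorem isComp_synth (hg : PowersRepresentedBy φ g) {C : ℝ} (hC : ∀ n, ‖g n‖ ≤ C) (f : WD) :
    IsComp φ f (synth hC f) := fun s hs => by
  have hsum := (hasSum_synth hC f).mapL (evalCLM (le_of_lt hs))
  rw [evalCLM_apply] at hsum
  exact hsum.congr_fun fun n => by rw [map_smul, evalCLM_apply, hg n hs, smul_eq_mul]

theorem PowersBounded.compBounded (h : PowersBounded φ) : CompBounded φ := by
  obtain ⟨g, hg, C, hC⟩ := h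
  exact ⟨synth hC, isComp_synth hg hC⟩

theorem PowersRepresentedBy.norm_cpow_neg_le (hg : PowersRepresentedBy φ g) (n : ℕ+) {s : ℂ}
    (hs : s ∈ halfPlane 0) : ‖((n : ℕ) : ℂ) ^ (-φ s)‖ ≤ ‖g n‖ :=
  (congrArg norm (hg n hs)).symm.trans_le (norm_eval_le (g n) (le_of_lt hs))

theorem PowersBounded.mapsTo (h : PowersBounded φ) (hd : DifferentiableOn ℂ φ (halfPlane 0))
    (hnc : ¬ ∃ w : ℂ, ∀ s ∈ halfPlane 0, φ s = w) : MapsTo φ (halfPlane 0) (halfPlane 0) := by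
  obtain ⟨g, hg, C, hC⟩ := h
  have hopen : IsOpen (φ '' halfPlane 0) :=
    ((hd.analyticOnNhd (isOpen_halfPlane 0)).is_constant_or_isOpen
      (isPreconnected_halfPlane 0)).resolve_left hnc _ subset_rfl (isOpen_halfPlane 0)
  have hclosed : φ '' halfPlane 0 ⊆ {z | 0 ≤ z.re} := by
    rintro _ ⟨s, hs, rfl⟩
    exact re_nonneg_of_norm_cpow_neg_le fun n => (hg.norm_cpow_neg_le n hs).trans (hC n)
  have hint : φ '' halfPlane 0 ⊆ {z | 0 < z.re} := by
    simpa only [Complex.interior_setOfPred_le_re] using interior_maximal hclosed hopen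
  exact mapsTo_iff_image_subset.2 hint

theorem CompCompact.compBounded (h : CompCompact φ) : CompBounded φ :=
  let ⟨T, hT, _⟩ := h
  ⟨T, hT⟩

theorem CompCompact.powersTendToZero (h : CompCompact φ)
    (hφ : MapsTo φ (halfPlane 0) (halfPlane 0)) : PowersTendToZero φ := by
  obtain ⟨T, hT, hc⟩ := h
  have hrep := powersRepresentedBy_of_isComp hT
  refine ⟨_, hrep, tendsto_zero_iff_norm_tendsto_zero.1 <| tendsto_zero_of_isCompactOperator hc
    (ℓ := fun s : halfPlane 0 => evalCLM (le_of_lt s.2))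
    (fun f hf => eq_zero_of_eval_eq_zero fun s hs => by simpa using hf ⟨s, hs⟩)
    (fun n => (norm_basis n).le) fun s => ?_⟩
  exact (tendsto_cpow_neg (hφ s.2)).congr fun n => by rw [evalCLM_apply, hrep n s.2]

theorem cofinite_pnat_eq_atTop : (cofinite : Filter ℕ+) = atTop := by
  refine le_antisymm (atTop_basis.ge_iff.2 fun n _ => ?_) atTop_le_cofinite
  rw [mem_cofinite, compl_Ici]
  exact finite_Iio n

theorem PowersTendToZero.compCompact (h : PowersTendToZero φ) : CompCompact φ := by
  obtain ⟨g, hg, h0⟩ := h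
  rw [← tendsto_zero_iff_norm_tendsto_zero, ← cofinite_pnat_eq_atTop] at h0
  obtain ⟨C, hC⟩ := h0.norm.bddAbove_range_of_cofinite
  replace hC : ∀ n, ‖g n‖ ≤ C := forall_mem_range.1 hC
  exact ⟨synth hC, isComp_synth hg hC, isCompactOperator_synth hC h0⟩

theorem PowersTendToZero.exists_mapsTo (h : PowersTendToZero φ) :
    ∃ δ : ℝ, 0 < δ ∧ MapsTo φ (halfPlane 0) (halfPlane δ) := by
  obtain ⟨g, hg, h0⟩ := h
  obtain ⟨n, hn, hn1⟩ := ((h0.eventually_lt_const one_half_pos).and (eventually_gt_atTop 1)).exists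
  have hlog : 0 < Real.log n := Real.log_pos (by exact_mod_cast hn1)
  refine ⟨Real.log 2 / Real.log n, div_pos (Real.log_pos one_lt_two) hlog, fun s hs => ?_⟩
  have hpow : ((n : ℕ) : ℝ) ^ (-(φ s).re) < 2⁻¹ := by
    simpa [norm_cpow_neg] using (hg.norm_cpow_neg_le n hs).trans_lt hn
  have hlt := Real.log_lt_log (by positivity) hpow
  rw [Real.log_rpow (by positivity), Real.log_inv] at hlt
  exact (div_lt_iff₀ hlog).2 (by linarith)

end Composition

/-! ### Mean values of absolutely convergent trigonometric series -/

section MeanValue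

open MeasureTheory ProbabilityTheory

theorem norm_exp_ofReal_mul_ofReal_mul_I (x t : ℝ) : ‖Complex.exp (x * t * Complex.I)‖ = 1 := by
  rw [← Complex.ofReal_mul, Complex.norm_exp_ofReal_mul_I]

variable {ι : Type*} [Countable ι] {a : ι → ℂ} {l : ι → ℝ}

theorem re_tsum_mul_charFun_nonneg (ha : Summable fun j => ‖a j‖)
    (h : ∀ t : ℝ, 0 ≤ (∑' j, a j * Complex.exp (l j * t * Complex.I)).re)
    (μ : Measure ℝ) [IsFiniteMeasure μ] : 0 ≤ (∑' j, a j * charFun μ (l j)).re := by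
  let u : ι → ℝ → ℂ := fun j t => a j * Complex.exp (l j * t * Complex.I)
  have hu : ∀ j t, ‖u j t‖ = ‖a j‖ := fun j t => by
    rw [norm_mul, norm_exp_ofReal_mul_ofReal_mul_I, mul_one]
  have hcont : ∀ j, Continuous (u j) := fun j => by fun_prop
  have hint : Integrable (fun t => ∑' j, u j t) μ :=
    .of_bound (continuous_tsum hcont ha fun j t => (hu j t).le).aestronglyMeasurable (∑' j, ‖a j‖)
      (.of_forall fun t => tsum_of_norm_bounded ha.hasSum fun j => (hu j t).le)
  have hsum : ∑' j, a j * charFun μ (l j) = ∫ t, ∑' j, u j t ∂μ := by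
    simp only [charFun_apply_real, ← integral_const_mul]
    refine (hasSum_integral_of_summable_integral_norm (fun j => ?_) ?_).tsum_eq
    · exact .of_bound (hcont j).aestronglyMeasurable ‖a j‖ (.of_forall fun t => (hu j t).le)
    · change Summable fun j => ∫ t, ‖u j t‖ ∂μ
      simpa only [hu, integral_const, smul_eq_mul] using ha.mul_left _
  have hre := Complex.reCLM.integral_comp_comm hint
  rw [hsum, ← Complex.reCLM_apply, ← hre]
  exact integral_nonneg h

theorem tendsto_charFun_gaussianReal_zero {x : ℝ} (hx : x ≠ 0) :
    Tendsto (fun v : ℕ => charFun (gaussianReal 0 v) x) atTop (𝓝 0) := by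
  have hre (v : ℕ) : (x * (0 : ℝ) * Complex.I - (v : NNReal) * x ^ 2 / 2 : ℂ).re =
      -(v * (x ^ 2 / 2)) := by
    simp [← Complex.ofReal_pow, mul_div_assoc]
  simp only [charFun_gaussianReal, Complex.tendsto_exp_nhds_zero_iff, hre]
  exact tendsto_neg_atTop_atBot.comp
    (tendsto_natCast_atTop_atTop.atTop_mul_const (by positivity))

theorem re_tsum_zero_frequency_nonneg (ha : Summable fun j => ‖a j‖)
    (h : ∀ t : ℝ, 0 ≤ (∑' j, a j * Complex.exp (l j * t * Complex.I)).re) :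
    0 ≤ (∑' j : {j // l j = 0}, a j).re := by
  have hlim : Tendsto (fun v : ℕ => ∑' j, a j * charFun (gaussianReal 0 v) (l j)) atTop
      (𝓝 (∑' j, {j | l j = 0}.indicator a j)) := by
    refine tendsto_tsum_of_dominated_convergence ha (fun j => ?_) (.of_forall fun v j => ?_)
    · have hchar : Tendsto (fun v : ℕ => charFun (gaussianReal 0 v) (l j)) atTop
          (𝓝 (if l j = 0 then 1 else 0)) := by
        split_ifs with hj
        · simp [hj]
        · exact tendsto_charFun_gaussianReal_zero hj
      simpa [indicator_apply] using hchar.const_mul (a j)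
    · rw [norm_mul]
      exact mul_le_of_le_one_right (norm_nonneg _) (norm_charFun_le_one _)
  rw [show ∑' j : {j // l j = 0}, a j = ∑' j, {j | l j = 0}.indicator a j from
    tsum_subtype {j | l j = 0} a]
  exact ge_of_tendsto ((Complex.continuous_re.tendsto _).comp hlim)
    (.of_forall fun v => re_tsum_mul_charFun_nonneg ha h _)

end MeanValue

/-! ### Characters of `ℕ+` -/

open scoped ComplexConjugate

theorem cpow_neg_mul_I (n : ℕ+) (t : ℝ) :
    ((n : ℕ) : ℂ) ^ (-(t * Complex.I)) = Complex.exp (-(Real.log n * t * Complex.I)) := by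
  rw [Complex.cpow_def_of_ne_zero (by simp), ← Complex.natCast_log]
  ring_nf

/-- The frequency in `t` of the product of the terms `k^{-it}`, `m^{-it}` and `n^{it}`. -/
def tripleFrequency (j : ℕ+ × ℕ+ × ℕ+) : ℝ :=
  Real.log j.2.2 - (Real.log j.1 + Real.log j.2.1)

theorem tripleFrequency_eq_zero_iff {k m n : ℕ+} : tripleFrequency (k, m, n) = 0 ↔ n = k * m := by
  have hpos (j : ℕ+) : (0 : ℝ) < j := Nat.cast_pos.2 j.pos
  rw [tripleFrequency, sub_eq_zero, ← Real.log_mul (hpos k).ne' (hpos m).ne',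
    Real.log_injOn_pos.eq_iff (hpos n) (mul_pos (hpos k) (hpos m))]
  norm_cast

theorem summable_norm_coeff_mul_cpow_neg (f : WD) {s : ℂ} (hs : 0 ≤ s.re) :
    Summable fun n : ℕ+ => ‖f n * ((n : ℕ) : ℂ) ^ (-s)‖ :=
  (summable_norm_coeff f).of_nonneg_of_le (fun _ => norm_nonneg _)
    (norm_coeff_mul_cpow_neg_le f hs)

theorem eval_mul_norm_eval_sq (f v : WD) (t : ℝ) :
    f.eval (t * Complex.I) * ‖v.eval (-(t * Complex.I))‖ ^ 2 =
      ∑' j : ℕ+ × ℕ+ × ℕ+, f j.1 * (conj (v j.2.1) * v j.2.2) *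
        Complex.exp (tripleFrequency j * t * Complex.I) := by
  have hf := summable_norm_coeff_mul_cpow_neg f (s := t * Complex.I) (by simp)
  have hv := summable_norm_coeff_mul_cpow_neg v (s := -(t * Complex.I)) (by simp)
  have hv' : Summable fun n : ℕ+ => ‖conj (v n * ((n : ℕ) : ℂ) ^ (-(-(t * Complex.I))))‖ := by
    simpa only [RCLike.norm_conj] using hv
  rw [← Complex.conj_mul', WD.eval, WD.eval, Complex.conj_tsum,
    tsum_mul_tsum_of_summable_norm hv' hv, tsum_mul_tsum_of_summable_norm hf (hv'.mul_norm hv)]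
  refine tsum_congr fun j => ?_
  have hI (n : ℕ+) : ((n : ℕ) : ℂ) ^ (-(-(t * Complex.I))) =
      Complex.exp (Real.log n * t * Complex.I) := by
    simpa using cpow_neg_mul_I n (-t)
  simp only [hI, cpow_neg_mul_I, map_mul, ← Complex.exp_conj, Complex.conj_ofReal, Complex.conj_I,
    tripleFrequency, Complex.ofReal_sub, Complex.ofReal_add]
  rw [show ((Real.log j.2.2 - (Real.log j.1 + Real.log j.2.1) : ℂ)) * t * Complex.I =
    -(Real.log j.1 * t * Complex.I) + (Real.log j.2.1 * t * -Complex.I +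
      Real.log j.2.2 * t * Complex.I) by ring, Complex.exp_add, Complex.exp_add]
  ring

theorem tsum_tripleFrequency_eq_zero {χ : ℕ+ →* ℂ} (hχ : ∀ n, ‖χ n‖ ≤ 1)
    (hsum : Summable fun n => ‖χ n‖ ^ 2) (f : WD) :
    ∑' j : {j // tripleFrequency j = 0}, f j.1.1 * (conj (χ j.1.2.1) * χ j.1.2.2) =
      synth hχ f * ((∑' n, ‖χ n‖ ^ 2 : ℝ) : ℂ) := by
  let e : ℕ+ × ℕ+ ≃ {j // tripleFrequency j = 0} :=
    { toFun := fun q => ⟨(q.1, q.2, q.1 * q.2), tripleFrequency_eq_zero_iff.2 rfl⟩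
      invFun := fun j => (j.1.1, j.1.2.1)
      left_inv := fun q => rfl
      right_inv := fun ⟨(k, m, n), h⟩ => by simp [tripleFrequency_eq_zero_iff.1 h] }
  have hf : Summable fun n => ‖f n * χ n‖ :=
    (summable_norm_coeff f).of_nonneg_of_le (fun _ => norm_nonneg _) fun n => by
      rw [norm_mul]
      exact mul_le_of_le_one_right (norm_nonneg _) (hχ n)
  have hsum' : Summable fun n => ‖((‖χ n‖ ^ 2 : ℝ) : ℂ)‖ := by simpa using hsum
  have hsynth : synth hχ f = ∑' n, f n * χ n := (hasSum_synth hχ f).tsum_eq.symm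
  rw [hsynth, Complex.ofReal_tsum, tsum_mul_tsum_of_summable_norm hf hsum', ← e.tsum_eq]
  refine tsum_congr fun q => ?_
  simp only [e, Equiv.coe_fn_mk, map_mul, Complex.ofReal_pow, ← Complex.conj_mul']
  ring

theorem re_synth_nonneg_of_summable {f : WD} (hf : ∀ t : ℝ, 0 ≤ (f.eval (t * Complex.I)).re)
    {χ : ℕ+ →* ℂ} (hχ : ∀ n, ‖χ n‖ ≤ 1) (hsum : Summable fun n => ‖χ n‖) :
    0 ≤ (synth hχ f).re := by
  obtain ⟨v, hv⟩ : ∃ v : WD, ∀ n, v n = χ n :=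
    ⟨⟨fun n => χ n, memℓp_gen (by simpa using hsum)⟩, fun _ => rfl⟩
  have hsq : Summable fun n => ‖χ n‖ ^ 2 := hsum.of_nonneg_of_le (fun _ => sq_nonneg _) fun n =>
    pow_le_of_le_one (norm_nonneg _) (hχ n) two_ne_zero
  let b : ℕ+ × ℕ+ → ℂ := fun q => conj (χ q.1) * χ q.2
  let a : ℕ+ × ℕ+ × ℕ+ → ℂ := fun j => f j.1 * b j.2
  have hconj : Summable fun n => ‖conj (χ n)‖ := by simpa only [RCLike.norm_conj] using hsum
  have hb : Summable fun q => ‖b q‖ := hconj.mul_norm hsum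
  have ha : Summable fun j => ‖a j‖ := (summable_norm_coeff f).mul_norm (f := f) (g := b) hb
  have hprod (t : ℝ) : f.eval (t * Complex.I) * ‖v.eval (-(t * Complex.I))‖ ^ 2 =
      ∑' j, a j * Complex.exp (tripleFrequency j * t * Complex.I) := by
    simpa only [hv] using eval_mul_norm_eval_sq f v t
  have htriple : 0 ≤ (synth hχ f * ((∑' n, ‖χ n‖ ^ 2 : ℝ) : ℂ)).re := by
    rw [← tsum_tripleFrequency_eq_zero hχ hsq f]
    refine re_tsum_zero_frequency_nonneg ha fun t => ?_
    rw [← hprod, ← Complex.ofReal_pow, Complex.re_mul_ofReal]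
    exact mul_nonneg (hf t) (sq_nonneg _)
  rw [Complex.re_mul_ofReal] at htriple
  exact nonneg_of_mul_nonneg_left htriple
    (hsq.tsum_pos (fun _ => sq_nonneg _) 1 (by simp))

/-- The completely multiplicative function `n ↦ n ^ (-1 / (N + 1))` on the `N`-smooth numbers,
extended by `0`. These functions are summable and tend to `1` as `N → ∞`, so that products with
them approximate an arbitrary bounded character by summable ones. -/
def smoothDamping (N : ℕ) : ℕ+ →* ℂ where
  toFun n := N.smoothNumbers.indicator (fun k => (k : ℂ) ^ (-((1 / (N + 1) : ℝ) : ℂ))) (n : ℕ)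
  map_one' := by
    rw [indicator_of_mem (by simp [Nat.mem_smoothNumbers])]
    simp
  map_mul' m n := by
    classical
    have hmem : (m * n : ℕ) ∈ N.smoothNumbers ↔
        (m : ℕ) ∈ N.smoothNumbers ∧ (n : ℕ) ∈ N.smoothNumbers :=
      ⟨fun h => ⟨Nat.mem_smoothNumbers_of_dvd h (dvd_mul_right _ _),
        Nat.mem_smoothNumbers_of_dvd h (dvd_mul_left _ _)⟩,
        fun h => Nat.mul_mem_smoothNumbers h.1 h.2⟩
    simp only [PNat.mul_coe, indicator_apply, hmem, Nat.cast_mul,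
      Complex.natCast_mul_natCast_cpow, ite_zero_mul_ite_zero]

theorem smoothDamping_apply (N : ℕ) (n : ℕ+) : smoothDamping N n =
    N.smoothNumbers.indicator (fun k => (k : ℂ) ^ (-((1 / (N + 1) : ℝ) : ℂ))) (n : ℕ) :=
  rfl

theorem norm_smoothDamping_le_one (N : ℕ) (n : ℕ+) : ‖smoothDamping N n‖ ≤ 1 := by
  rw [smoothDamping_apply]
  refine norm_indicator_le_norm_self _ _ |>.trans (norm_cpow_neg_le_one ?_ n)
  rw [Complex.ofReal_re]
  positivity

theorem summable_norm_smoothDamping (N : ℕ) : Summable fun n => ‖smoothDamping N n‖ := by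
  let ψ : ℕ →* ℂ :=
    { toFun := fun k => (k : ℂ) ^ (-((1 / (N + 1) : ℝ) : ℂ))
      map_one' := by simp
      map_mul' := fun m n => by rw [Nat.cast_mul, Complex.natCast_mul_natCast_cpow] }
  have hψ : ∀ {p : ℕ}, p.Prime → ‖ψ p‖ < 1 := fun {p} hp => by
    change ‖(p : ℂ) ^ (-((1 / (N + 1) : ℝ) : ℂ))‖ < 1
    rw [Complex.norm_natCast_cpow_of_pos hp.pos, Complex.neg_re, Complex.ofReal_re]
    exact Real.rpow_lt_one_of_one_lt_of_neg (mod_cast hp.one_lt)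
      (neg_neg_of_pos (by positivity))
  have hsum : Summable (N.smoothNumbers.indicator fun k => ‖ψ k‖) :=
    summable_subtype_iff_indicator.1
      (EulerProduct.summable_and_hasSum_smoothNumbers_prod_primesBelow_geometric hψ N).1
  refine (hsum.comp_injective PNat.coe_injective).congr fun n => ?_
  rw [smoothDamping_apply, norm_indicator_eq_indicator_norm]
  rfl

theorem tendsto_smoothDamping (n : ℕ+) :
    Tendsto (fun N => smoothDamping N n) atTop (𝓝 1) := by
  have hexp : Tendsto (fun N : ℕ => -(1 / (N + 1) : ℂ)) atTop (𝓝 0) := by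
    simpa using (tendsto_one_div_add_atTop_nhds_zero_nat (𝕜 := ℂ)).neg
  have hpow : Tendsto (fun N : ℕ => ((n : ℕ) : ℂ) ^ (-((1 / (N + 1) : ℝ) : ℂ))) atTop (𝓝 1) := by
    simpa using hexp.const_cpow (.inl (Nat.cast_ne_zero.2 n.ne_zero))
  refine hpow.congr' ?_
  filter_upwards [eventually_gt_atTop (n : ℕ)] with N hN
  rw [smoothDamping_apply, indicator_of_mem (Nat.mem_smoothNumbers_of_lt n.pos hN)]

theorem re_synth_nonneg {f : WD} (hf : ∀ t : ℝ, 0 ≤ (f.eval (t * Complex.I)).re)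
    {χ : ℕ+ →* ℂ} (hχ : ∀ n, ‖χ n‖ ≤ 1) : 0 ≤ (synth hχ f).re := by
  have hle (N : ℕ) (n : ℕ+) : ‖χ n * smoothDamping N n‖ ≤ 1 := by
    rw [norm_mul]
    exact mul_le_one₀ (hχ n) (norm_nonneg _) (norm_smoothDamping_le_one N n)
  have hnonneg (N : ℕ) : 0 ≤ (synth (hle N) f).re :=
    re_synth_nonneg_of_summable hf (χ := χ * smoothDamping N) (hle N) <|
      (summable_norm_smoothDamping N).of_nonneg_of_le (fun _ => norm_nonneg _) fun n => by
        rw [MonoidHom.mul_apply, norm_mul]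
        exact mul_le_of_le_one_left (norm_nonneg _) (hχ n)
  have hlim : Tendsto (fun N => synth (hle N) f) atTop (𝓝 (synth hχ f)) :=
    tendsto_synth hle hχ (fun n => by simpa using (tendsto_smoothDamping n).const_mul (χ n)) f
  exact ge_of_tendsto' ((Complex.continuous_re.tendsto _).comp hlim) hnonneg

theorem le_re_synth {f : WD} {δ : ℝ} (hf : ∀ t : ℝ, δ ≤ (f.eval (t * Complex.I)).re)
    {χ : ℕ+ →* ℂ} (hχ : ∀ n, ‖χ n‖ ≤ 1) : δ ≤ (synth hχ f).re := by
  have hshift (t : ℝ) : 0 ≤ ((f - (δ : ℂ) • basis 1).eval (t * Complex.I)).re := by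
    have ht : 0 ≤ (t * Complex.I).re := by simp
    rw [← evalCLM_apply ht, map_sub, map_smul, evalCLM_apply, evalCLM_apply, eval_basis _ ht]
    simpa using hf t
  simpa using re_synth_nonneg hshift hχ

/-! ### Exponentials in Banach algebras -/

section BanachAlgebra

variable {A B : Type*} [NormedCommRing A] [NormedAlgebra ℂ A] [CompleteSpace A]
  [NormedRing B] [NormedAlgebra ℂ B] [CompleteSpace B]

theorem tendsto_pow_of_spectralRadius_lt_one {b : B} (hb : spectralRadius ℂ b < 1) :
    Tendsto (fun n : ℕ => b ^ n) atTop (𝓝 0) := by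
  obtain ⟨r, hr, hr1⟩ := ENNReal.lt_iff_exists_nnreal_btwn.1 hb
  refine squeeze_zero_norm' ?_
    (tendsto_pow_atTop_nhds_zero_of_lt_one r.coe_nonneg (mod_cast hr1))
  filter_upwards [(spectrum.gelfand_formula b).eventually_lt_const hr, eventually_ne_atTop 0]
    with n hn hn0
  have hroot : ‖b ^ n‖₊ ≤ r ^ n := by
    rw [← ENNReal.coe_le_coe, ENNReal.coe_pow, ← ENNReal.rpow_natCast,
      ← ENNReal.rpow_inv_le_iff (by positivity)]
    simpa using hn.le
  exact mod_cast hroot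

theorem tendsto_exp_neg_smul_of_spectralRadius_lt_one {a : B}
    (ha : spectralRadius ℂ (NormedSpace.exp (-a)) < 1) :
    Tendsto (fun t : ℝ => NormedSpace.exp (-(t : ℂ) • a)) atTop (𝓝 0) := by
  let _ : NormedAlgebra ℚ B := NormedAlgebra.restrictScalars ℚ ℂ B
  let P : ℝ → B := fun t => NormedSpace.exp (-(t : ℂ) • a)
  have hcont : Continuous P := NormedSpace.exp_continuous.comp (by fun_prop)
  have hsplit (t : ℝ) : P t = NormedSpace.exp (-a) ^ ⌊t⌋₊ * P (t - ⌊t⌋₊) := by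
    rw [← NormedSpace.exp_nsmul, ← NormedSpace.exp_add_of_commute]
    · refine congrArg NormedSpace.exp ?_
      rw [← Nat.cast_smul_eq_nsmul ℂ]
      push_cast
      module
    · exact ((Commute.refl a).neg_left.smul_left _).smul_right _
  obtain ⟨C, hC⟩ := (isCompact_Icc (a := (0 : ℝ)) (b := 1)).exists_bound_of_continuousOn
    hcont.continuousOn
  have hlim : Tendsto (fun t : ℝ => ‖NormedSpace.exp (-a) ^ ⌊t⌋₊‖ * C) atTop (𝓝 0) := by
    simpa using ((tendsto_pow_of_spectralRadius_lt_one ha).comp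
      tendsto_nat_floor_atTop).norm.mul_const C
  refine squeeze_zero_norm' ?_ hlim
  filter_upwards [eventually_ge_atTop 0] with t ht
  have hfrac : t - ⌊t⌋₊ ∈ Icc (0 : ℝ) 1 :=
    ⟨sub_nonneg.2 (Nat.floor_le ht), by linarith [Nat.lt_floor_add_one t]⟩
  calc ‖P t‖ ≤ ‖NormedSpace.exp (-a) ^ ⌊t⌋₊‖ * ‖P (t - ⌊t⌋₊)‖ := by
        rw [hsplit]
        exact norm_mul_le _ _
    _ ≤ _ := by
        gcongr
        exact hC _ hfrac

theorem norm_lt_one_of_mem_spectrum_exp_neg {a : A}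
    (ha : ∀ ψ : WeakDual.characterSpace ℂ A, 0 < (ψ a).re) {z : ℂ}
    (hz : z ∈ spectrum ℂ (NormedSpace.exp (-a))) : ‖z‖ < 1 := by
  let _ : NormedAlgebra ℚ A := NormedAlgebra.restrictScalars ℚ ℂ A
  obtain ⟨ψ, rfl⟩ := WeakDual.CharacterSpace.mem_spectrum_iff_exists.1 hz
  rw [NormedSpace.map_exp ψ (map_continuous ψ), ← Complex.exp_eq_exp_ℂ, Complex.norm_exp]
  simpa using ha ψ

variable {f : WD} {δ : ℝ}

theorem le_re_character_synth [NormOneClass A] (hf : ∀ t : ℝ, δ ≤ (f.eval (t * Complex.I)).re)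
    {M : ℕ+ →* A} (hM : ∀ n, ‖M n‖ ≤ 1) (ψ : WeakDual.characterSpace ℂ A) :
    δ ≤ (ψ (synth hM f)).re := by
  let χ : ℕ+ →* ℂ := (ψ : A →* ℂ).comp M
  have hχ : ∀ n, ‖χ n‖ ≤ 1 := fun n => (AlgHom.norm_apply_le_self ψ (M n)).trans (hM n)
  have hmap : ψ (synth hM f) = synth hχ f :=
    ((hasSum_synth hM f).map ψ (map_continuous ψ)).unique <| by
      simpa [Function.comp_def, χ] using hasSum_synth hχ f
  rw [hmap]
  exact le_re_synth hf hχ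

theorem norm_lt_one_of_mem_spectrum_exp_neg_synth [NormOneClass B] (hδ : 0 < δ)
    (hf : ∀ t : ℝ, δ ≤ (f.eval (t * Complex.I)).re) {M : ℕ+ →* B} (hM : ∀ n, ‖M n‖ ≤ 1) {z : ℂ}
    (hz : z ∈ spectrum ℂ (NormedSpace.exp (-synth hM f))) : ‖z‖ < 1 := by
  let S : Subalgebra ℂ B := Algebra.adjoin ℂ (range M)
  have hS : IsMulCommutative S := Algebra.isMulCommutative_adjoin ℂ <| by
    rintro _ ⟨m, rfl⟩ _ ⟨n, rfl⟩
    rw [← map_mul, ← map_mul, mul_comm]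
  let A : Subalgebra ℂ B := S.topologicalClosure
  let _ : NormedCommRing A :=
    { (inferInstance : NormedRing A) with
      mul_comm := (S.commRingTopologicalClosure hS.is_comm.comm).mul_comm }
  have : CompleteSpace A := S.isClosed_topologicalClosure.completeSpace_coe
  have : NormOneClass A := ⟨norm_one (α := B)⟩
  let _ : NormedAlgebra ℚ A := NormedAlgebra.restrictScalars ℚ ℂ A
  let _ : NormedAlgebra ℚ B := NormedAlgebra.restrictScalars ℚ ℂ B
  have hval : Continuous A.val := continuous_subtype_val
  let M' : ℕ+ →* A :=
    M.codRestrict A fun n => S.le_topologicalClosure (Algebra.subset_adjoin ⟨n, rfl⟩)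
  have hM' : ∀ n, ‖M' n‖ ≤ 1 := hM
  have hsynth : A.val (synth hM' f) = synth hM f :=
    ((hasSum_synth hM' f).map A.val hval).unique (hasSum_synth hM f)
  rw [← hsynth, ← map_neg, ← NormedSpace.map_exp A.val hval] at hz
  exact norm_lt_one_of_mem_spectrum_exp_neg
    (fun ψ => hδ.trans_le (le_re_character_synth hf hM' ψ))
    (AlgHom.spectrum_apply_subset A.val _ hz)

theorem tendsto_exp_neg_smul_synth [NormOneClass B] (hδ : 0 < δ)
    (hf : ∀ t : ℝ, δ ≤ (f.eval (t * Complex.I)).re) {M : ℕ+ →* B} (hM : ∀ n, ‖M n‖ ≤ 1) :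
    Tendsto (fun t : ℝ => NormedSpace.exp (-(t : ℂ) • synth hM f)) atTop (𝓝 0) := by
  have : Nontrivial B := NormOneClass.nontrivial
  exact tendsto_exp_neg_smul_of_spectralRadius_lt_one <|
    spectrum.spectralRadius_lt_of_forall_lt _ fun z hz =>
      norm_lt_one_of_mem_spectrum_exp_neg_synth hδ hf hM hz

end BanachAlgebra

/-! ### Multiplication operators on `𝒜⁺` -/

theorem norm_basis_mul_le (k n : ℕ+) : ‖basis (k * n)‖ ≤ 1 := (norm_basis _).le

/-- Multiplication by `k^{-s}` on `𝒜⁺`. -/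
def shift : ℕ+ →* (WD →L[ℂ] WD) where
  toFun k := synth (norm_basis_mul_le k)
  map_one' := (eq_synth _ 1 fun n => by simp [basis]).symm
  map_mul' k l := (eq_synth _ _ fun n => by
    change synth (norm_basis_mul_le k) (synth (norm_basis_mul_le l) (basis n)) = _
    rw [synth_basis, synth_basis, mul_assoc]).symm

theorem norm_shift_le (k : ℕ+) : ‖shift k‖ ≤ 1 :=
  norm_synth_le zero_le_one (norm_basis_mul_le k)

theorem eval_shift {s : ℂ} (hs : 0 ≤ s.re) (k : ℕ+) (f : WD) :
    (shift k f).eval s = ((k : ℕ) : ℂ) ^ (-s) * f.eval s := by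
  rw [← evalCLM_apply hs]
  refine ((hasSum_synth (norm_basis_mul_le k) f).mapL (evalCLM hs)).unique
    (((hasSum_eval f hs).mul_left _).congr_fun fun n => ?_)
  rw [map_smul, evalCLM_apply, eval_basis _ hs, PNat.mul_coe, Nat.cast_mul,
    Complex.natCast_mul_natCast_cpow, smul_eq_mul, mul_left_comm]

theorem evalCLM_comp_synth_shift (f : WD) {s : ℂ} (hs : 0 ≤ s.re) :
    evalCLM hs ∘L synth norm_shift_le f = f.eval s • evalCLM hs := by
  have hcomp (n : ℕ+) : evalCLM hs ∘L shift n = ((n : ℕ) : ℂ) ^ (-s) • evalCLM hs := by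
    ext g
    simp [eval_shift hs]
  refine ((hasSum_synth norm_shift_le f).mapL ((evalCLM hs).postcomp WD)).unique
    (((hasSum_eval f hs).smul_const _).congr_fun fun n => ?_)
  rw [map_smul, ContinuousLinearMap.postcomp_apply, hcomp, smul_smul]

theorem eval_exp_smul_synth_shift (z : ℂ) (f g : WD) {s : ℂ} (hs : 0 ≤ s.re) :
    (NormedSpace.exp (z • synth norm_shift_le f) g).eval s =
      Complex.exp (z * f.eval s) * g.eval s := by
  have hexp := comp_exp_of_comp_eq_smul (L := evalCLM hs) (T := z • synth norm_shift_le f)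
    (z := z * f.eval s) (by rw [ContinuousLinearMap.comp_smul, evalCLM_comp_synth_shift, smul_smul])
  simpa [Complex.exp_eq_exp_ℂ] using DFunLike.congr_fun hexp g

/-! ### Absolutely convergent symbols -/

theorem HasDirichletExpansion.exists_eqOn_eval {ϕ : ℂ → ℂ}
    (hd : DifferentiableOn ℂ ϕ (halfPlane 0)) {c : ℕ+ → ℂ} (h : HasDirichletExpansion ϕ c)
    (hc : Summable fun n => ‖c n‖) : ∃ f : WD, EqOn ϕ f.eval (halfPlane 0) := by
  obtain ⟨f, hf⟩ : ∃ f : WD, ∀ n, f n = c n :=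
    ⟨⟨c, memℓp_gen (by simpa using hc)⟩, fun _ => rfl⟩
  obtain ⟨σ, hσ⟩ := h
  have hmem : ((max σ 0 + 1 : ℝ) : ℂ) ∈ halfPlane (max σ 0) := by
    change max σ 0 < max σ 0 + 1
    exact lt_add_one _
  have hsub : halfPlane (max σ 0) ⊆ halfPlane 0 := fun s hs => (le_max_right σ 0).trans_lt hs
  refine ⟨f, (hd.analyticOnNhd (isOpen_halfPlane 0)).eqOn_of_preconnected_of_eventuallyEq
    ((differentiableOn_eval f).analyticOnNhd (isOpen_halfPlane 0)) (isPreconnected_halfPlane 0)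
    (hsub hmem) ?_⟩
  filter_upwards [(isOpen_halfPlane (max σ 0)).mem_nhds hmem] with s hs
  have hpartial : Tendsto (Finset.Icc (1 : ℕ+)) atTop atTop :=
    tendsto_atTop_finset_of_monotone (fun M N hMN => Finset.Icc_subset_Icc_right hMN)
      fun n => ⟨n, Finset.mem_Icc.2 ⟨one_le, le_rfl⟩⟩
  have heval := (hasSum_eval f (le_of_lt (hsub hs))).comp hpartial
  simp only [hf] at heval
  exact tendsto_nhds_unique (hσ s ((le_max_left σ 0).trans_lt hs)) heval

section Symbol

variable {c₀ : ℕ} {φ : ℂ → ℂ} {f : WD} {δ : ℝ}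
  (hφ : ∀ s ∈ halfPlane 0, φ s = (c₀ : ℂ) * s + f.eval s)

include hφ

theorem le_re_eval_mul_I (hmaps : MapsTo φ (halfPlane 0) (halfPlane δ)) (t : ℝ) :
    δ ≤ (f.eval (t * Complex.I)).re := by
  have hclosure : closure (halfPlane 0) = {s | 0 ≤ s.re} := Complex.closure_setOfPred_lt_re 0
  have hcont : ContinuousOn (fun s => ((c₀ : ℂ) * s + f.eval s).re) (closure (halfPlane 0)) := by
    rw [hclosure]
    exact Complex.continuous_re.comp_continuousOn
      (Continuous.continuousOn (by fun_prop) |>.add (continuousOn_eval f))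
  have hle : δ ≤ ((c₀ : ℂ) * (t * Complex.I) + f.eval (t * Complex.I)).re :=
    le_on_closure (f := fun _ => δ) (fun s hs => (hφ s hs ▸ hmaps hs).le)
      continuousOn_const hcont (by simp [hclosure])
  simpa using hle

theorem powersRepresentedBy_shift_exp : PowersRepresentedBy φ fun n =>
    shift (n ^ c₀) (NormedSpace.exp (-(Real.log n : ℂ) • synth norm_shift_le f) (basis 1)) := by
  intro n s hs
  have hs' : 0 ≤ s.re := le_of_lt hs
  have hn : ((n : ℕ) : ℂ) ≠ 0 := Nat.cast_ne_zero.2 n.ne_zero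
  have hlog : Complex.log (((n : ℕ) : ℂ) ^ c₀) = c₀ * Complex.log (n : ℕ) := by
    rw [← Nat.cast_pow, ← Complex.natCast_log, Nat.cast_pow, Real.log_pow, Complex.ofReal_mul,
      Complex.natCast_log, Complex.ofReal_natCast]
  simp only [eval_shift hs', eval_exp_smul_synth_shift _ _ _ hs', eval_basis _ hs', hφ s hs]
  rw [PNat.one_coe, Nat.cast_one, Complex.one_cpow, mul_one, PNat.pow_coe, Nat.cast_pow,
    Complex.natCast_log, Complex.cpow_def_of_ne_zero hn,
    Complex.cpow_def_of_ne_zero (pow_ne_zero _ hn), ← Complex.exp_add, hlog]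
  ring_nf

theorem powersTendToZero_of_mapsTo (hδ : 0 < δ) (hmaps : MapsTo φ (halfPlane 0) (halfPlane δ)) :
    PowersTendToZero φ := by
  have : Nontrivial WD := ⟨basis 1, 0, norm_pos_iff.1 (by simp)⟩
  refine ⟨_, powersRepresentedBy_shift_exp hφ, tendsto_zero_iff_norm_tendsto_zero.1 ?_⟩
  have hexp : Tendsto (fun t : ℝ => NormedSpace.exp (-(t : ℂ) • synth norm_shift_le f)) atTop
      (𝓝 0) := tendsto_exp_neg_smul_synth hδ (le_re_eval_mul_I hφ hmaps) norm_shift_le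
  have hlog : Tendsto (fun n : ℕ+ => Real.log n) atTop atTop :=
    Real.tendsto_log_atTop.comp (tendsto_natCast_atTop_atTop.comp tendsto_PNat_val_atTop_atTop)
  refine squeeze_zero_norm (fun n => ?_)
    (tendsto_zero_iff_norm_tendsto_zero.1 (hexp.comp hlog))
  refine ((shift (n ^ c₀)).le_of_opNorm_le (norm_shift_le _) _).trans ?_
  rw [one_mul]
  exact (ContinuousLinearMap.le_opNorm _ _).trans_eq (by rw [norm_basis, mul_one]; rfl)

end Symbol

end WienerDirichlet

end

open WienerDirichlet in
theorem theorem2p2_general (c₀ : ℕ) (φ ϕ : ℂ → ℂ) (hϕ : DifferentiableOn ℂ ϕ (halfPlane 0))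
    (hφ : ∀ s ∈ halfPlane 0, φ s = (c₀ : ℂ) * s + ϕ s)
    (hnc : ¬ ∃ w : ℂ, ∀ s ∈ halfPlane 0, φ s = w) :
    (CompMapsInto φ → PowersBounded φ) ∧
    (PowersBounded φ → Set.MapsTo φ (halfPlane 0) (halfPlane 0) ∧ CompBounded φ) ∧
    (CompCompact φ ↔ PowersTendToZero φ) ∧
    (CompCompact φ → ∃ δ : ℝ, 0 < δ ∧ Set.MapsTo φ (halfPlane 0) (halfPlane δ)) ∧
    (∀ c : ℕ+ → ℂ, HasDirichletExpansion ϕ c → Summable (fun n => ‖c n‖) →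
      (CompCompact φ ↔ ∃ δ : ℝ, 0 < δ ∧ Set.MapsTo φ (halfPlane 0) (halfPlane δ))) := by
  have hd : DifferentiableOn ℂ φ (halfPlane 0) :=
    (((differentiable_id.const_mul (c₀ : ℂ)).differentiableOn).add hϕ).congr hφ
  have hbounded : PowersBounded φ → MapsTo φ (halfPlane 0) (halfPlane 0) := fun h =>
    h.mapsTo hd hnc
  have hzero : CompCompact φ → PowersTendToZero φ := fun h =>
    h.powersTendToZero (hbounded h.compBounded.powersBounded)
  have hδ : CompCompact φ → ∃ δ : ℝ, 0 < δ ∧ MapsTo φ (halfPlane 0) (halfPlane δ) := fun h =>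
    (hzero h).exists_mapsTo
  refine ⟨fun h => h.compBounded.powersBounded, fun h => ⟨hbounded h, h.compBounded⟩,
    ⟨hzero, fun h => h.compCompact⟩, hδ, fun c hexp hc => ⟨hδ, ?_⟩⟩
  rintro ⟨δ, hδ0, hmaps⟩
  obtain ⟨f, hf⟩ := hexp.exists_eqOn_eval hϕ hc
  have hφf : ∀ s ∈ halfPlane 0, φ s = (c₀ : ℂ) * s + f.eval s := fun s hs => by
    rw [hφ s hs, hf hs]
  exact (powersTendToZero_of_mapsTo hφf hδ0 hmaps).compCompact

open WienerDirichlet in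
theorem theorem2p2 (c₀ : ℕ) (φ ϕ : ℂ → ℂ) (hϕ : IsConvergentDirichletSeries ϕ)
    (hφ : ∀ s ∈ halfPlane 0, φ s = (c₀ : ℂ) * s + ϕ s)
    (hnc : ¬ ∃ w : ℂ, ∀ s ∈ halfPlane 0, φ s = w) :
    (CompMapsInto φ → PowersBounded φ) ∧
    (PowersBounded φ → Set.MapsTo φ (halfPlane 0) (halfPlane 0) ∧ CompBounded φ) ∧
    (CompCompact φ ↔ PowersTendToZero φ) ∧
    (CompCompact φ → ∃ δ : ℝ, 0 < δ ∧ Set.MapsTo φ (halfPlane 0) (halfPlane δ)) ∧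
    (∀ c : ℕ+ → ℂ, HasDirichletExpansion ϕ c → Summable (fun n => ‖c n‖) →
      (CompCompact φ ↔ ∃ δ : ℝ, 0 < δ ∧ Set.MapsTo φ (halfPlane 0) (halfPlane δ))) :=
  theorem2p2_general c₀ φ ϕ hϕ.1 hφ hnc
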